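/- Let $(\mathcal A,\varphi)$ and $(\mathcal A',\psi)$ be $C^*$-probability spaces (unital $C^*$-algebras with states, possibly the same), let $n\ge 1$, and let $\sigma_i$ ($1\le i\le n$) and $\alpha_{ij},\tilde\alpha_{ij}$ ($1\le j<i\le n$) be real numbers. Elements $(x_k)$ of $\mathcal A$ are called Boolean independent if $\varphi(y_1\cdots y_m)=\varphi(y_1)\cdots\varphi(y_m)$ whenever each $y_l$ lies in the non-unital $*$-subalgebra generated by $x_{k_l}$ and $k_1\ne k_2\ne\dots\ne k_m$ (neighbouring indices differ). The Boolean cumulants $\beta_m$ are defined by $\varphi(x_1\cdots x_m)=\sum_{\pi}\prod_{V\in\pi}\beta_{|V|}\big((x_l)_{l\in V}\big)$, the sum being over all interval partitions $\pi$ of $\{1,\dots,m\}$ and the arguments in each block being taken in increasing order. The same notions are used for $(\mathcal A',\psi)$. Let $a=\{a_{ij}\mid 1\le j\le i\le n\}\subset\mathcal A$ be a Boolean independent family with $\varphi(a_{ij})=0$ for all $j\le i$; $a_{ii}=a_{ii}^*$ and $\varphi(a_{ii}^2)=\sigma_i$ for all $i$; and $\varphi(a_{ij}^2)=0$, $\varphi(a_{ij}a_{ij}^*)=\alpha_{ij}$,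 $\varphi(a_{ij}^*a_{ij})=\tilde\alpha_{ij}$ for all $j<i$. Let $b=\{b_{ij}\mid 1\le j\le i\le n\}\subset\mathcal A'$ be a Boolean independent family such that * each $b_{ii}$ is a self-adjoint Bernoulli element of variance $\sigma_i$, that is, $b_{ii}=b_{ii}^*$, $\psi(b_{ii}^{2k})=\sigma_i^k$ and $\psi(b_{ii}^{2k+1})=0$ for all $k\ge 0$; * for $j<i$, $b_{ij}$ is $\eta$-circular, that is, all Boolean cumulants of the form $\beta_m(b_{ij}^{\varepsilon_1},\dots,b_{ij}^{\varepsilon_m})$ with $m\ge 1$ and $\varepsilon_1,\dots,\varepsilon_m\in\{1,*\}$ vanish except possibly $\beta_2(b_{ij},b_{ij}^*)$ and $\beta_2(b_{ij}^*,b_{ij})$; moreover $\psi(b_{ij})=0$, $\psi(b_{ij}b_{ij}^*)=\alpha_{ij}$ and $\psi(b_{ij}^*b_{ij})=\tilde\alpha_{ij}$. With the matrix units $E_{ij}$ of $M_n(\mathbb C)$, put $e_{ii}=\frac1{2\sqrt n}E_{ii}$ and $e_{ij}=\frac1{\sqrt n}E_{ij}$ for $j<i$, and $$A_n=\sum_{1\le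 j\le i\le n}\big(e_{ij}\otimes a_{ij}+e_{ij}^*\otimes a_{ij}^*\big)\in M_n(\mathcal A),\qquad B_n=\sum_{1\le j\le i\le n}\big(e_{ij}\otimes b_{ij}+e_{ij}^*\otimes b_{ij}^*\big)\in M_n(\mathcal A').$$ Let $\operatorname{tr}_n$ be the normalized trace on $M_n(\mathbb C)$ and $G_X(z)=(z-X)^{-1}$. Then for every $z\in\mathbb C$ with $\operatorname{Im}z>0$ the matrices $z-A_n$ and $z-B_n$ are invertible, and $$\big|(\operatorname{tr}_n\otimes\varphi)[G_{A_n}(z)]-(\operatorname{tr}_n\otimes\psi)[G_{B_n}(z)]\big|\le\frac{16}{(\operatorname{Im}z)^4}\Big(\max_{1\le j\le i\le n}\|a_{ij}\|^3\Big)\frac1{\sqrt n}.$$ -/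

import Mathlib

open scoped ComplexOrder

namespace BooleanMatrix

/-- `φ` is a state on the unital C*-algebra `A`: a unital positive linear functional. -/
structure IsState {A : Type*} [CStarAlgebra A] (φ : A →ₗ[ℂ] ℂ) : Prop where
  map_one : φ 1 = 1
  nonneg : ∀ x : A, 0 ≤ φ (star x * x)

/-- Boolean independence, with respect to `φ`, of (possibly non-unital) `*`-subalgebras:
`φ (x₁ ⋯ xₘ) = φ x₁ ⋯ φ xₘ` whenever `xₖ ∈ S iₖ` and neighbouring indices are different.
The list `l` consists of the pairs `(iₖ, xₖ)`. -/
def BooleanIndep {A ι : Type*} [CStarAlgebra A] (φ : A →ₗ[ℂ] ℂ)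
    (S : ι → NonUnitalStarSubalgebra ℂ A) : Prop :=
  ∀ l : List (ι × A), l ≠ [] → l.IsChain (fun p q => p.1 ≠ q.1) → (∀ p ∈ l, p.2 ∈ S p.1) →
    φ (l.map Prod.snd).prod = (l.map (fun p => φ p.2)).prod

/-- Boolean independence of a family of elements (up to symmetry, that is, together with their
adjoints): the non-unital `*`-subalgebras that they generate are Boolean independent. -/
def BooleanIndepElems {A ι : Type*} [CStarAlgebra A] (φ : A →ₗ[ℂ] ℂ) (x : ι → A) : Prop :=
  BooleanIndep φ (fun i => NonUnitalStarAlgebra.adjoin ℂ {x i})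

/-- The Boolean cumulant `βₘ(x₁, …, xₘ)` of a non-empty list `[x₁, …, xₘ]`, given by
`φ (x₁ ⋯ xₘ) = ∑_{k=1}^m βₖ(x₁, …, xₖ) φ (x_{k+1} ⋯ xₘ)`, which is the moment-cumulant formula
over interval partitions with the partitions sorted by their first block; see
`moment_eq_sum_booleanCumulant`. -/
noncomputable def booleanCumulant {A : Type*} [CStarAlgebra A] (φ : A →ₗ[ℂ] ℂ)
    (l : List A) : ℂ :=
  φ l.prod - ∑ k : Fin (l.length - 1),
    booleanCumulant φ (l.take (k + 1)) * φ (l.drop (k + 1)).prod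
termination_by l.length
decreasing_by
  have := k.isLt
  simp only [List.length_take]
  omega

theorem moment_eq_sum_take {A : Type*} [CStarAlgebra A] (φ : A →ₗ[ℂ] ℂ) (h1 : φ 1 = 1)
    (l : List A) (hl : l ≠ []) :
    φ l.prod = ∑ k : Fin l.length,
      booleanCumulant φ (l.take (k + 1)) * φ (l.drop (k + 1)).prod := by
  obtain ⟨m, hm⟩ : ∃ m, l.length = m + 1 :=
    Nat.exists_eq_succ_of_ne_zero (by simpa using hl)
  have h := booleanCumulant.eq_1 φ l
  rw [← Fin.sum_congr' (fun k : Fin l.length =>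
    booleanCumulant φ (l.take (k + 1)) * φ (l.drop (k + 1)).prod) hm.symm, Fin.sum_univ_castSucc]
  rw [← Fin.sum_congr' (fun k : Fin (l.length - 1) =>
    booleanCumulant φ (l.take (k + 1)) * φ (l.drop (k + 1)).prod)
      (show m = l.length - 1 by omega)] at h
  have e1 : l.take (m + 1) = l := List.take_of_length_le (by omega)
  have e2 : l.drop (m + 1) = [] := List.drop_of_length_le (by omega)
  simp only [Fin.val_cast, Fin.val_castSucc, Fin.val_last, e1, e2, List.prod_nil, h1, mul_one]
    at h ⊢
  rw [h]
  ring

/-- The moment-cumulant formula: the sum runs over the interval partitions of the list. -/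
theorem moment_eq_sum_booleanCumulant {A : Type*} [CStarAlgebra A] (φ : A →ₗ[ℂ] ℂ)
    (h1 : φ 1 = 1) (l : List A) (n : ℕ) (hn : l.length = n) :
    φ l.prod = ∑ c : Composition n,
      ((l.splitWrtComposition c).map (booleanCumulant φ)).prod := by
  induction n using Nat.strong_induction_on generalizing l with
  | _ n ih =>
    subst hn
    by_cases hl : l = []
    · subst hl
      have hu : ∀ c : Composition ([] : List A).length, c.blocks = [] := fun c =>
        List.length_eq_zero_iff.mp (Nat.le_zero.mp c.length_le)
      have : Fintype.card (Composition 0) = 1 := by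
        simp [composition_card]
      simp [List.splitWrtComposition, hu, h1, List.splitWrtCompositionAux, this]
    · rw [moment_eq_sum_take φ h1 l hl]
      have hpos : 0 < l.length := List.length_pos_iff.mpr hl
      have step : ∀ k : Fin l.length,
          booleanCumulant φ (l.take (k + 1)) * φ (l.drop (k + 1)).prod =
          ∑ c : Composition (l.length - (k + 1)), booleanCumulant φ (l.take (k + 1)) *
            (((l.drop (k + 1)).splitWrtComposition c).map (booleanCumulant φ)).prod := by
        intro k
        rw [ih (l.length - (k + 1)) (by omega) (l.drop (k + 1)) (by simp), Finset.mul_sum]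
      rw [Finset.sum_congr rfl (fun k _ => step k), ← Finset.sum_sigma Finset.univ
        (fun k : Fin l.length => (Finset.univ : Finset (Composition (l.length - (k + 1)))))
        (fun p => booleanCumulant φ (l.take (p.1 + 1)) *
            (((l.drop (p.1 + 1)).splitWrtComposition p.2).map (booleanCumulant φ)).prod)]
      refine Finset.sum_bij (fun p _ => (⟨(p.1 + 1) :: p.2.blocks, ?_, ?_⟩ :
        Composition l.length)) ?_ ?_ ?_ ?_
      · intro i hi
        rcases List.mem_cons.mp hi with rfl | hi
        · omega
        · exact p.2.blocks_pos hi
      · have := p.1.isLt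
        simp only [List.sum_cons, p.2.blocks_sum]
        omega
      · simp
      · rintro ⟨k, c⟩ _ ⟨k', c'⟩ _ h
        have h' := congrArg Composition.blocks h
        simp only [List.cons.injEq] at h'
        obtain ⟨e1, e2⟩ := h'
        have e3 : k = k' := Fin.ext (by omega)
        subst e3
        have e4 : c = c' := Composition.ext e2
        rw [e4]
      · rintro c _
        obtain ⟨bs, hb, hs⟩ := c
        cases bs with
        | nil => simp at hs; omega
        | cons a t =>
          have ha : 0 < a := hb (by simp)
          simp only [List.sum_cons] at hs
          refine ⟨⟨⟨a - 1, by omega⟩, ⟨t, fun hi => hb (by simp [hi]), ?_⟩⟩, by simp, ?_⟩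
          · simp only
            omega
          · apply Composition.ext
            simp only [List.cons.injEq, and_true]
            omega
      · rintro ⟨k, c⟩ _
        simp [List.splitWrtComposition, List.splitWrtCompositionAux_cons]

/-- The alternating word `x, star x, x, star x, …, x, star x` of length `2 * k`. -/
def alternatingWord {A : Type*} [Star A] (x : A) (k : ℕ) : List A :=
  (List.replicate k [x, star x]).flatten

/-- The word `x^{ε₁}, …, x^{εₘ}` in `x` and `star x`, where `true` stands for `star`. -/
def starWord {A : Type*} [Star A] (x : A) (ε : List Bool) : List A :=
  ε.map (fun e => if e then star x else x)

/-- `x` is `η`-diagonal: a Boolean cumulant `βₘ(x^{ε₁}, …, x^{εₘ})` vanishes unless the word is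
`x, x*, …, x, x*` or `x*, x, …, x*, x`. -/
def IsEtaDiagonal {A : Type*} [CStarAlgebra A] (φ : A →ₗ[ℂ] ℂ) (x : A) : Prop :=
  ∀ ε : List Bool,
    (∀ k : ℕ, ε ≠ (List.replicate k [false, true]).flatten) →
    (∀ k : ℕ, ε ≠ (List.replicate k [true, false]).flatten) →
    booleanCumulant φ (starWord x ε) = 0

/-- `x` is `η`-circular: it is `η`-diagonal, and `βₘ(x, x*, …, x, x*)` and
`βₘ(x*, x, …, x*, x)` vanish unless `m = 2`. -/
structure IsEtaCircular {A : Type*} [CStarAlgebra A] (φ : A →ₗ[ℂ] ℂ) (x : A) : Prop where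
  etaDiagonal : IsEtaDiagonal φ x
  cumulant_left : ∀ k : ℕ, 2 ≤ k → booleanCumulant φ (alternatingWord x k) = 0
  cumulant_right : ∀ k : ℕ, 2 ≤ k → booleanCumulant φ (alternatingWord (star x) k) = 0

/-- `x` is a (scalar-valued, centred, self-adjoint) Bernoulli element with variance `s`:
its even moments are `φ (x ^ (2 k)) = s ^ k` and its odd moments vanish. -/
structure IsBernoulli {A : Type*} [CStarAlgebra A] (φ : A →ₗ[ℂ] ℂ) (x : A) (s : ℝ) : Prop where
  selfAdjoint : IsSelfAdjoint x
  moment_even : ∀ k : ℕ, φ (x ^ (2 * k)) = (s : ℂ) ^ k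
  moment_odd : ∀ k : ℕ, φ (x ^ (2 * k + 1)) = 0

/-- The index set `{(i, j) | j ≤ i}`. -/
abbrev LowerIndex (n : ℕ) : Type := {p : Fin n × Fin n // p.2 ≤ p.1}

/-- The family of entries of a Boolean Wigner matrix with variance profile `σ`, `α`, `α'`. -/
structure IsBooleanWignerFamily {A : Type*} [CStarAlgebra A] (φ : A →ₗ[ℂ] ℂ) {n : ℕ}
    (σ : Fin n → ℝ) (α α' : Fin n → Fin n → ℝ) (a : LowerIndex n → A) : Prop where
  indep : BooleanIndepElems φ a
  centered : ∀ p, φ (a p) = 0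
  diag_selfAdjoint : ∀ i : Fin n, IsSelfAdjoint (a ⟨(i, i), le_rfl⟩)
  diag_var : ∀ i : Fin n, φ (a ⟨(i, i), le_rfl⟩ ^ 2) = (σ i : ℂ)
  sq : ∀ (i j : Fin n) (h : j < i), φ (a ⟨(i, j), h.le⟩ ^ 2) = 0
  var_left : ∀ (i j : Fin n) (h : j < i),
    φ (a ⟨(i, j), h.le⟩ * star (a ⟨(i, j), h.le⟩)) = (α i j : ℂ)
  var_right : ∀ (i j : Fin n) (h : j < i),
    φ (star (a ⟨(i, j), h.le⟩) * a ⟨(i, j), h.le⟩) = (α' i j : ℂ)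

/-- A Boolean independent family with Bernoulli elements on the diagonal and `η`-circular elements
below it, with variance profile `σ`, `α`, `α'`. -/
structure IsBernoulliCircularFamily {A : Type*} [CStarAlgebra A] (φ : A →ₗ[ℂ] ℂ) {n : ℕ}
    (σ : Fin n → ℝ) (α α' : Fin n → Fin n → ℝ) (b : LowerIndex n → A) : Prop where
  indep : BooleanIndepElems φ b
  diag_bernoulli : ∀ i : Fin n, IsBernoulli φ (b ⟨(i, i), le_rfl⟩) (σ i)
  etaCircular : ∀ (i j : Fin n) (h : j < i), IsEtaCircular φ (b ⟨(i, j), h.le⟩)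
  centered : ∀ (i j : Fin n) (h : j < i), φ (b ⟨(i, j), h.le⟩) = 0
  var_left : ∀ (i j : Fin n) (h : j < i),
    φ (b ⟨(i, j), h.le⟩ * star (b ⟨(i, j), h.le⟩)) = (α i j : ℂ)
  var_right : ∀ (i j : Fin n) (h : j < i),
    φ (star (b ⟨(i, j), h.le⟩) * b ⟨(i, j), h.le⟩) = (α' i j : ℂ)

/-- The elementary tensor `M ⊗ x` of `M_n(ℂ) ⊗ A = M_n(A)`. -/
def tens {A : Type*} [CStarAlgebra A] {n : ℕ} (M : Matrix (Fin n) (Fin n) ℂ) (x : A) :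
    Matrix (Fin n) (Fin n) A :=
  M.map (fun c => c • x)

/-- The scaled matrix units: `e_{ii} = E_{ii} / (2 √n)`, and `e_{ij} = E_{ij} / √n` for `j < i`. -/
noncomputable def scaledUnit {n : ℕ} (p : LowerIndex n) : Matrix (Fin n) (Fin n) ℂ :=
  if p.1.1 = p.1.2 then (1 / (2 * (Real.sqrt n : ℂ))) • Matrix.single p.1.1 p.1.2 1
  else (1 / (Real.sqrt n : ℂ)) • Matrix.single p.1.1 p.1.2 1

/-- The self-adjoint matrix `∑_{j ≤ i} (e_{ij} ⊗ a_{ij} + e_{ij}* ⊗ a_{ij}*)`. -/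
noncomputable def wignerMatrix {A : Type*} [CStarAlgebra A] {n : ℕ} (a : LowerIndex n → A) :
    Matrix (Fin n) (Fin n) A :=
  ∑ p : LowerIndex n,
    (tens (scaledUnit p) (a p) + tens (scaledUnit p).conjTranspose (star (a p)))

/-- The functional `tr_n ⊗ φ` on `M_n(A)`, with `tr_n` the normalized trace. -/
noncomputable def trTensor {A : Type*} [CStarAlgebra A] (φ : A →ₗ[ℂ] ℂ) {n : ℕ}
    (M : Matrix (Fin n) (Fin n) A) : ℂ :=
  (1 / (n : ℂ)) * ∑ i, φ (M i i)

end BooleanMatrix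

namespace BooleanMatrix

/-! Write `M` for the matrix, `G` for its resolvent at `z`, and `d_i = ∑ k, φ (M i k * M k i)`, a
number fixed by the variance profile and hence common to both models. Applying `z G = 1 + M G` twice
to `φ (G i i)` produces words `M i k * M k l * G l i`. For `l ≠ i` the first two factors involve
different generators, so Boolean independence and centring kill the term, leaving `z² φ (G i i) = z
+ ∑ k, φ (M i k * M k i * G i i)` (`sq_mul_apply_resolvent`).

In the Bernoulli/`η`-circular model `M i k * M k i` splits off multiplicatively from everything to
its right, whence `(z² - d_i) ψ (G i i) = z` exactly. In the general model one more expansion of `G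
i i` shows that the splitting fails only through third-order terms in one entry, each `O(n^(-3/2))`.
Summing over `k` gives the same equation up to `O(n^(-1/2))` (`norm_sub_mul_apply_resolvent_le`).
Since `d_i ≥ 0`, `|z² - d_i| ≥ (Im z)²`, so the diagonal entries can be compared after division, and
then averaged over `i`. -/

/-! ### States, and resolvents of self-adjoint elements and Hermitian matrices -/

theorem IsState.apply_star {A : Type*} [CStarAlgebra A] {φ : A →ₗ[ℂ] ℂ} (hφ : IsState φ) (x : A) :
    φ (star x) = star (φ x) := by
  let _ := CStarAlgebra.spectralOrder A
  have _ := CStarAlgebra.spectralOrderedRing A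
  let f : A →ₚ[ℂ] ℂ := PositiveLinearMap.mk₀ φ fun y hy => by
    obtain ⟨b, rfl⟩ := CStarAlgebra.nonneg_iff_eq_star_mul_self.mp hy
    exact hφ.nonneg b
  exact map_star f x

/-- Variance argument: `φ (|x - φ x|²) ≥ 0` gives `|φ x|² ≤ φ (x* x)`, and `x* x ≤ ‖x‖²`. -/
theorem IsState.norm_apply_le {A : Type*} [CStarAlgebra A] {φ : A →ₗ[ℂ] ℂ} (hφ : IsState φ)
    (x : A) : ‖φ x‖ ≤ ‖x‖ := by
  let _ := CStarAlgebra.spectralOrder A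
  have _ := CStarAlgebra.spectralOrderedRing A
  have h1 : 0 ≤ φ (algebraMap ℝ A (‖x‖ ^ 2) - star x * x) := by
    obtain ⟨b, hb⟩ := CStarAlgebra.nonneg_iff_eq_star_mul_self.mp
      (sub_nonneg.mpr (CStarAlgebra.star_mul_le_algebraMap_norm_sq (a := x)))
    rw [hb]
    exact hφ.nonneg b
  have h2 := hφ.nonneg (x - algebraMap ℂ A (φ x))
  have e1 : algebraMap ℝ A (‖x‖ ^ 2) = ((‖x‖ ^ 2 : ℝ) : ℂ) • (1 : A) := by
    rw [Algebra.algebraMap_eq_smul_one, Complex.coe_smul]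
  have e2 : φ (star (x - algebraMap ℂ A (φ x)) * (x - algebraMap ℂ A (φ x))) =
      φ (star x * x) - star (φ x) * φ x := by
    simp only [Algebra.algebraMap_eq_smul_one, star_sub, star_smul, star_one, mul_sub, sub_mul,
      smul_mul_assoc, mul_smul_comm, one_mul, mul_one, map_sub, map_smul, hφ.map_one,
      hφ.apply_star, smul_eq_mul]
    ring
  rw [e1, map_sub, map_smul, hφ.map_one, smul_eq_mul, mul_one] at h1
  rw [e2] at h2
  have h3 := add_nonneg h1 h2
  rw [sub_add_sub_cancel, Complex.star_def, Complex.conj_mul', ← Complex.ofReal_pow,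
    ← Complex.ofReal_sub, Complex.zero_le_real, sub_nonneg] at h3
  exact (sq_le_sq₀ (norm_nonneg _) (norm_nonneg _)).mp h3

/-- The spectrum is real, so `|z - w| ≥ Im z` on it, and the functional calculus turns this into a
norm bound. -/
theorem norm_resolvent_le_of_isSelfAdjoint {A : Type*} [CStarAlgebra A] {x : A}
    (hx : IsSelfAdjoint x) {z : ℂ} (hz : 0 < z.im) :
    z ∈ resolventSet ℂ x ∧ ‖resolvent x z‖ ≤ 1 / z.im := by
  have hne : ∀ w ∈ spectrum ℂ x, z.im ≤ ‖z - w‖ := fun w hw => by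
    have h1 := Complex.abs_im_le_norm (z - w)
    rw [Complex.sub_im, hx.im_eq_zero_of_mem_spectrum hw, sub_zero] at h1
    exact (le_abs_self _).trans h1
  have hmem : z ∈ resolventSet ℂ x := by
    by_contra h
    have := hne z h
    rw [sub_self, norm_zero] at this
    exact this.not_gt hz
  have hn : IsStarNormal x := hx.isStarNormal
  have hne0 : ∀ w ∈ spectrum ℂ x, z - w ≠ 0 := fun w hw h0 => by
    have := hne w hw
    rw [h0, norm_zero] at this
    exact this.not_gt hz
  have hinv : cfc (fun w : ℂ => (z - w)⁻¹) x = resolvent x z := by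
    rw [cfc_inv (fun w : ℂ => z - w) x hne0, cfc_sub (fun _ : ℂ => z) (fun w => w) x, cfc_const z x, cfc_id' ℂ x]
    rfl
  refine ⟨hmem, ?_⟩
  rw [← hinv]
  refine norm_cfc_le (by positivity) fun w hw => ?_
  rw [norm_inv, inv_eq_one_div]
  exact one_div_le_one_div_of_le hz (hne w hw)

theorem _root_.Matrix.IsHermitian.norm_resolvent_apply_le {A ι : Type*} [CStarAlgebra A]
    [Fintype ι] [DecidableEq ι] {M : Matrix ι ι A} (hM : M.IsHermitian) {z : ℂ}
    (hz : 0 < z.im) :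
    z ∈ resolventSet ℂ M ∧ ∀ i j, ‖resolvent M z i j‖ ≤ 1 / z.im := by
  let _ := CStarAlgebra.spectralOrder A
  have _ := CStarAlgebra.spectralOrderedRing A
  have hx : IsSelfAdjoint (CStarMatrix.ofMatrix M) := hM
  obtain ⟨h1, h2⟩ := norm_resolvent_le_of_isSelfAdjoint hx hz
  exact ⟨h1, fun i j => (CStarMatrix.norm_entry_le_norm
    (M := resolvent (CStarMatrix.ofMatrix M) z)).trans h2⟩

/-- Matrices over the C*-algebra `V` already contain an inverse of `z - M`, and inverses are unique.
This lets Boolean independence act on resolvent entries. -/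
theorem _root_.Matrix.IsHermitian.resolvent_apply_mem {A ι : Type*} [CStarAlgebra A]
    [Fintype ι] [DecidableEq ι] {M : Matrix ι ι A} (hM : M.IsHermitian) {z : ℂ}
    (hz : 0 < z.im) (V : StarSubalgebra ℂ A) (hV : IsClosed (V : Set A))
    (hMV : ∀ i j, M i j ∈ V) (i j : ι) : resolvent M z i j ∈ V := by
  let N : Matrix ι ι V := fun i j => ⟨M i j, hMV i j⟩
  have : IsClosed (V : Set A) := hV
  let _ : CStarAlgebra V := StarSubalgebra.cstarAlgebra V
  have hN : N.IsHermitian := Matrix.ext fun i j => Subtype.ext (congrFun (congrFun hM i) j)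
  have h1 := (hN.norm_resolvent_apply_le hz).1
  let f : Matrix ι ι V →ₐ[ℂ] Matrix ι ι A := V.subtype.toAlgHom.mapMatrix
  have h2 : f (algebraMap ℂ _ z - N) = algebraMap ℂ _ z - M := by
    rw [map_sub, AlgHom.commutes]
    rfl
  have h3 : resolvent M z = f (resolvent N z) := by
    have h4 : (algebraMap ℂ _ z - M) * f (resolvent N z) = 1 := by
      rw [← h2, ← map_mul, resolvent, Ring.mul_inverse_cancel _ h1, map_one]
    have h5 := (hM.norm_resolvent_apply_le hz).1
    calc resolvent M z
        = resolvent M z * ((algebraMap ℂ _ z - M) * f (resolvent N z)) := by rw [h4, mul_one]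
      _ = f (resolvent N z) := by
        rw [← mul_assoc, resolvent, Ring.inverse_mul_cancel _ h5, one_mul]
  rw [h3]
  exact (resolvent N z i j).2

/-! ### Expansions from the resolvent identity -/

theorem smul_resolvent_apply {A ι : Type*} [Ring A] [Algebra ℂ A] [Fintype ι] [DecidableEq ι]
    {M : Matrix ι ι A} {z : ℂ} (hz : z ∈ resolventSet ℂ M) (i j : ι) :
    z • resolvent M z i j = (if i = j then 1 else 0) + ∑ k, M i k * resolvent M z k j := by
  have h := Ring.mul_inverse_cancel _ hz
  have h' := congrFun (congrFun h i) j
  rw [sub_mul, Algebra.algebraMap_eq_smul_one, smul_mul_assoc, one_mul, Matrix.sub_apply,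
    Matrix.smul_apply, Matrix.mul_apply, sub_eq_iff_eq_add, Matrix.one_apply] at h'
  simpa only [resolvent, Algebra.algebraMap_eq_smul_one] using h'

theorem sq_mul_apply_eq_of_expansion {A ι : Type*} [Ring A] [Algebra ℂ A] [Fintype ι]
    [DecidableEq ι] {φ : A →ₗ[ℂ] ℂ} (h1 : φ 1 = 1) {M G : Matrix ι ι A} {z : ℂ}
    (hG : ∀ i j, z • G i j = (if i = j then 1 else 0) + ∑ k, M i k * G k j)
    (hc : ∀ i k, φ (M i k) = 0)
    (hM : ∀ i k l, l ≠ i → φ (M i k * (M k l * G l i)) = 0) (i : ι) :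
    z ^ 2 * φ (G i i) = z + ∑ k, φ (M i k * M k i * G i i) := by
  have e1 : z * φ (G i i) = 1 + ∑ k, φ (M i k * G k i) := by
    rw [← smul_eq_mul, ← map_smul, hG, map_add, map_sum, if_pos rfl, h1]
  have e2 : ∀ k, z * φ (M i k * G k i) = φ (M i k * M k i * G i i) := fun k => by
    rw [← smul_eq_mul, ← map_smul, ← mul_smul_comm, hG, mul_add, Finset.mul_sum, map_add,
      map_sum, Finset.sum_eq_single i (fun l _ hl => hM i k l hl) (by simp), mul_assoc]
    split_ifs <;> simp [hc]
  rw [sq, mul_assoc, e1, mul_add, mul_one, Finset.mul_sum]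
  simp only [e2]

/-- Expand `G i i` on both sides: the constant terms agree, the terms `l ≠ k` cancel by `hM`, and
only the defect at `l = k` remains. -/
theorem mul_apply_mul_mul_eq_of_expansion {A ι : Type*} [Ring A] [Algebra ℂ A] [Fintype ι]
    [DecidableEq ι] {φ : A →ₗ[ℂ] ℂ} (h1 : φ 1 = 1) {M G : Matrix ι ι A} {z : ℂ}
    (hG : ∀ i j, z • G i j = (if i = j then 1 else 0) + ∑ k, M i k * G k j)
    (hM : ∀ i k l, l ≠ k → φ (M i k * M k i * (M i l * G l i)) =
      φ (M i k * M k i) * φ (M i l * G l i)) (i k : ι) :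
    z * φ (M i k * M k i * G i i) = z * (φ (M i k * M k i) * φ (G i i)) +
      (φ (M i k * M k i * (M i k * G k i)) - φ (M i k * M k i) * φ (M i k * G k i)) := by
  have e1 : z * φ (G i i) = 1 + ∑ k, φ (M i k * G k i) := by
    rw [← smul_eq_mul, ← map_smul, hG, map_add, map_sum, if_pos rfl, h1]
  have e2 : ∑ l, φ (M i k * M k i * (M i l * G l i)) -
      ∑ l, φ (M i k * M k i) * φ (M i l * G l i) =
      φ (M i k * M k i * (M i k * G k i)) - φ (M i k * M k i) * φ (M i k * G k i) := by
    rw [← Finset.sum_sub_distrib, Finset.sum_eq_single k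
      (fun l _ hl => by rw [hM i k l hl, sub_self]) (by simp)]
  rw [mul_left_comm, e1, mul_add, mul_one, Finset.mul_sum, ← e2, ← smul_eq_mul, ← map_smul,
    ← mul_smul_comm, hG, mul_add, Finset.mul_sum, map_add, map_sum, if_pos rfl, mul_one]
  ring

/-! ### Boolean independence extended to the closed generated algebra -/

/-- Merging neighbours of equal index makes any word alternating. The leading letter keeps its index
`q`, so a letter of another index can still be put in front. -/
theorem exists_isChain_prod_eq {A ι : Type*} [CStarAlgebra A]
    (S : ι → NonUnitalStarSubalgebra ℂ A) (l : List (ι × A)) (hl : ∀ p ∈ l, p.2 ∈ S p.1)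
    (q : ι) (v : A) (hv : v ∈ S q) :
    ∃ (w : A) (t : List (ι × A)), w ∈ S q ∧ (∀ p ∈ t, p.2 ∈ S p.1) ∧
      ((q, w) :: t).IsChain (fun p r => p.1 ≠ r.1) ∧
      w * (t.map Prod.snd).prod = v * (l.map Prod.snd).prod := by
  induction l generalizing q v with
  | nil => exact ⟨v, [], hv, by simp, by simp, rfl⟩
  | cons p l ih =>
    obtain ⟨r, x⟩ := p
    have hx : x ∈ S r := hl (r, x) (by simp)
    obtain ⟨w, t, hw, ht, hc, he⟩ := ih (fun p hp => hl p (by simp [hp])) r x hx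
    by_cases hrq : q = r
    · subst hrq
      refine ⟨v * w, t, mul_mem hv hw, ht, ?_, ?_⟩
      · cases t with
        | nil => simp
        | cons s t =>
          rw [List.isChain_cons_cons] at hc ⊢
          exact hc
      · rw [mul_assoc, he, List.map_cons, List.prod_cons]
    · refine ⟨v, (r, w) :: t, hv, ?_, ?_, ?_⟩
      · intro p hp
        rcases List.mem_cons.mp hp with rfl | hp
        · exact hw
        · exact ht p hp
      · exact List.isChain_cons_cons.mpr ⟨hrq, hc⟩
      · rw [List.map_cons, List.prod_cons, he, List.map_cons, List.prod_cons]

/-- The closed unital `*`-subalgebra generated by a family. -/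
noncomputable def closedAdjoin {A ι : Type*} [CStarAlgebra A] (x : ι → A) : StarSubalgebra ℂ A :=
  (StarAlgebra.adjoin ℂ (Set.range x)).topologicalClosure

theorem isClosed_closedAdjoin {A ι : Type*} [CStarAlgebra A] (x : ι → A) :
    IsClosed (closedAdjoin x : Set A) :=
  StarSubalgebra.isClosed_topologicalClosure _

theorem mem_closedAdjoin {A ι : Type*} [CStarAlgebra A] (x : ι → A) (i : ι) :
    x i ∈ closedAdjoin x :=
  StarSubalgebra.le_topologicalClosure _ (StarAlgebra.subset_adjoin ℂ _ ⟨i, rfl⟩)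

theorem eq_of_mem_closedAdjoin {A ι : Type*} [CStarAlgebra A] {x : ι → A} {f g : A →ₗ[ℂ] ℂ}
    (hf : Continuous f) (hg : Continuous g)
    (h : ∀ l : List (ι × A), (∀ p ∈ l, p.2 ∈ NonUnitalStarAlgebra.adjoin ℂ {x p.1}) →
      f (l.map Prod.snd).prod = g (l.map Prod.snd).prod) {y : A} (hy : y ∈ closedAdjoin x) :
    f y = g y := by
  have hsub : (StarAlgebra.adjoin ℂ (Set.range x) : Set A) ⊆ {y | f y = g y} := by
    intro y hy
    have hy' : y ∈ Submodule.span ℂ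
        (Submonoid.closure (Set.range x ∪ star (Set.range x)) : Set A) := by
      rw [← StarAlgebra.adjoin_eq_span]
      exact hy
    refine LinearMap.eqOn_span (f := f) (g := g) (fun w hw => ?_) hy'
    obtain ⟨l, hl, rfl⟩ := Submonoid.exists_list_of_mem_closure hw
    have hl' : ∀ c ∈ l, ∃ i, c ∈ NonUnitalStarAlgebra.adjoin ℂ {x i} := by
      intro c hc
      rcases hl c hc with ⟨i, rfl⟩ | ⟨i, hi⟩
      · exact ⟨i, NonUnitalStarAlgebra.self_mem_adjoin_singleton ℂ _⟩
      · refine ⟨i, ?_⟩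
        rw [← star_star c, ← hi]
        exact NonUnitalStarAlgebra.star_self_mem_adjoin_singleton ℂ _
    obtain ⟨l', hl1, hl2⟩ : ∃ l' : List (ι × A), l'.map Prod.snd = l ∧
        ∀ p ∈ l', p.2 ∈ NonUnitalStarAlgebra.adjoin ℂ {x p.1} := by
      clear hl hw hy' hy
      induction l with
      | nil => exact ⟨[], rfl, by simp⟩
      | cons c l ih =>
        obtain ⟨l', h1, h2⟩ := ih fun c hc => hl' c (by simp [hc])
        obtain ⟨i, hi⟩ := hl' c (by simp)
        refine ⟨(i, c) :: l', by simp [h1], ?_⟩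
        intro p hp
        rcases List.mem_cons.mp hp with rfl | hp
        · exact hi
        · exact h2 p hp
    rw [← hl1]
    exact h l' hl2
  exact closure_minimal hsub (isClosed_eq hf hg) hy

theorem IsState.continuous {A : Type*} [CStarAlgebra A] {φ : A →ₗ[ℂ] ℂ} (hφ : IsState φ) :
    Continuous φ :=
  (φ.mkContinuous 1 fun x => by rw [one_mul]; exact hφ.norm_apply_le x).continuous

/-- The letter `v` shields `u` from `y`, which may itself begin with letters of index `p`. On words
this is independence; continuity does the rest. -/
theorem BooleanIndepElems.apply_mul_mul {A ι : Type*} [CStarAlgebra A] {φ : A →ₗ[ℂ] ℂ}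
    (hφ : IsState φ) {x : ι → A} (hx : BooleanIndepElems φ x) {p q : ι} (hpq : p ≠ q) {u v y : A}
    (hu : u ∈ NonUnitalStarAlgebra.adjoin ℂ {x p}) (hv : v ∈ NonUnitalStarAlgebra.adjoin ℂ {x q})
    (hy : y ∈ closedAdjoin x) : φ (u * (v * y)) = φ u * φ (v * y) := by
  have hc := hφ.continuous
  refine eq_of_mem_closedAdjoin
    (f := φ ∘ₗ LinearMap.mulLeft ℂ u ∘ₗ LinearMap.mulLeft ℂ v)
    (g := φ u • φ ∘ₗ LinearMap.mulLeft ℂ v) ?_ ?_ (fun l hl => ?_) hy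
  · exact hc.comp ((continuous_const_mul u).comp (continuous_const_mul v))
  · exact continuous_const.mul (hc.comp (continuous_const_mul v))
  · obtain ⟨w, t, hw, ht, hch, he⟩ :=
      exists_isChain_prod_eq (fun i => NonUnitalStarAlgebra.adjoin ℂ {x i}) l hl q v hv
    have h1 := hx ((q, w) :: t) (by simp) hch (by simpa [hw] using ht)
    have h2 := hx ((p, u) :: (q, w) :: t) (by simp) (List.isChain_cons_cons.mpr ⟨hpq, hch⟩)
      (by simpa [hu, hw] using ht)
    simp only [List.map_cons, List.prod_cons] at h1 h2
    simp only [LinearMap.comp_apply, LinearMap.smul_apply, LinearMap.mulLeft_apply, ← he,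
      smul_eq_mul]
    rw [h2, h1]

/-- A word in `y` starting with index `p` has its first letter absorbed into `u` and split by `hux`;
any other nonempty word splits by independence. -/
theorem BooleanIndepElems.apply_mul {A ι : Type*} [CStarAlgebra A] {φ : A →ₗ[ℂ] ℂ}
    (hφ : IsState φ) {x : ι → A} (hx : BooleanIndepElems φ x) {p : ι} {u y : A}
    (hu : u ∈ NonUnitalStarAlgebra.adjoin ℂ {x p})
    (hux : ∀ v ∈ NonUnitalStarAlgebra.adjoin ℂ {x p}, φ (u * v) = φ u * φ v)
    (hy : y ∈ closedAdjoin x) : φ (u * y) = φ u * φ y := by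
  have hc := hφ.continuous
  refine eq_of_mem_closedAdjoin
    (f := φ ∘ₗ LinearMap.mulLeft ℂ u) (g := φ u • φ) ?_ ?_ (fun l hl => ?_) hy
  · exact hc.comp (continuous_const_mul u)
  · exact continuous_const.mul hc
  cases l with
  | nil => simp [hφ.map_one]
  | cons r l =>
    obtain ⟨q, v⟩ := r
    have hv : v ∈ NonUnitalStarAlgebra.adjoin ℂ {x q} := hl (q, v) (by simp)
    obtain ⟨w, t, hw, ht, hch, he⟩ := exists_isChain_prod_eq
      (fun i => NonUnitalStarAlgebra.adjoin ℂ {x i}) l (fun r hr => hl r (by simp [hr])) q v hv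
    have h1 := hx ((q, w) :: t) (by simp) hch (by simpa [hw] using ht)
    simp only [List.map_cons, List.prod_cons] at h1
    simp only [List.map_cons, List.prod_cons, LinearMap.comp_apply, LinearMap.smul_apply,
      LinearMap.mulLeft_apply, ← he, smul_eq_mul]
    by_cases hpq : p = q
    · subst hpq
      have h2 := hx ((p, u * w) :: t) (by simp)
        (by
          cases t with
          | nil => simp
          | cons s t =>
            rw [List.isChain_cons_cons] at hch ⊢
            exact hch) (by simpa [mul_mem hu hw] using ht)
      simp only [List.map_cons, List.prod_cons] at h2
      rw [h1, ← mul_assoc, h2, hux w hw, mul_assoc]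
    · have h2 := hx ((p, u) :: (q, w) :: t) (by simp) (List.isChain_cons_cons.mpr ⟨hpq, hch⟩)
        (by simpa [hu, hw] using ht)
      simp only [List.map_cons, List.prod_cons] at h2
      rw [h2, h1]

/-! ### Splitting off two letters for Bernoulli and `η`-circular elements -/

theorem apply_mul_eq_of_starWord {A : Type*} [CStarAlgebra A] {φ : A →ₗ[ℂ] ℂ} {x u : A}
    (h : ∀ ε, φ (u * (starWord x ε).prod) = φ u * φ (starWord x ε).prod) {v : A}
    (hv : v ∈ NonUnitalStarAlgebra.adjoin ℂ {x}) : φ (u * v) = φ u * φ v := by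
  have hv' : v ∈ Submodule.span ℂ (Subsemigroup.closure ({x} ∪ star {x}) : Set A) := by
    rw [← NonUnitalStarAlgebra.adjoin_eq_span]
    exact hv
  refine LinearMap.eqOn_span (f := φ ∘ₗ LinearMap.mulLeft ℂ u) (g := φ u • φ)
    (fun w hw => ?_) hv'
  obtain ⟨ε, rfl⟩ : ∃ ε, (starWord x ε).prod = w := by
    induction hw using Subsemigroup.closure_induction with
    | mem w hw =>
      rcases hw with hw | hw
      · exact ⟨[false], by simpa [starWord] using hw.symm⟩
      · refine ⟨[true], ?_⟩
        rw [Set.mem_star, Set.mem_singleton_iff] at hw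
        simp [starWord, ← hw]
    | mul w₁ w₂ _ _ h₁ h₂ =>
      obtain ⟨ε₁, rfl⟩ := h₁
      obtain ⟨ε₂, rfl⟩ := h₂
      exact ⟨ε₁ ++ ε₂, by simp [starWord]⟩
  exact h ε

theorem IsBernoulli.apply_starWord {A : Type*} [CStarAlgebra A] {φ : A →ₗ[ℂ] ℂ} {x : A} {s : ℝ}
    (hx : IsBernoulli φ x s) (ε : List Bool) :
    φ (x * x * (starWord x ε).prod) = φ (x * x) * φ (starWord x ε).prod := by
  have h : (starWord x ε).prod = x ^ ε.length := by
    have : starWord x ε = List.replicate ε.length x := by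
      simp [starWord, hx.selfAdjoint.star_eq]
    rw [this, List.prod_replicate]
  have h2 : φ (x * x) = s := by simpa [sq] using hx.moment_even 1
  rw [h, h2, ← sq, ← pow_add]
  rcases Nat.even_or_odd' ε.length with ⟨k, hk | hk⟩
  · rw [hk, show 2 + 2 * k = 2 * (k + 1) by ring, hx.moment_even, hx.moment_even, pow_succ']
  · rw [hk, show 2 + (2 * k + 1) = 2 * (k + 1) + 1 by ring, hx.moment_odd, hx.moment_odd, mul_zero]

theorem IsEtaCircular.booleanCumulant_starWord {A : Type*} [CStarAlgebra A] {φ : A →ₗ[ℂ] ℂ}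
    {x : A} (hx : IsEtaCircular φ x) (ε : List Bool) (hε : ε ≠ []) (h2 : ε.length ≠ 2) :
    booleanCumulant φ (starWord x ε) = 0 := by
  have key : ∀ (e : Bool) (k : ℕ), ε = (List.replicate k [e, !e]).flatten → 2 ≤ k := by
    rintro e k rfl
    match k with
    | 0 => simp at hε
    | 1 => simp at h2
    | k + 2 => omega
  by_cases h : ∃ k, ε = (List.replicate k [false, true]).flatten
  · obtain ⟨k, rfl⟩ := h
    have := hx.cumulant_left k (key false k rfl)
    simpa [alternatingWord, starWord, List.map_flatten] using this
  by_cases h' : ∃ k, ε = (List.replicate k [true, false]).flatten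
  · obtain ⟨k, rfl⟩ := h'
    have := hx.cumulant_right k (key true k rfl)
    simpa [alternatingWord, starWord, List.map_flatten] using this
  exact hx.etaDiagonal ε (fun k hk => h ⟨k, hk⟩) (fun k hk => h' ⟨k, hk⟩)

/-- In the moment-cumulant recursion over the first block, only a block of size two can have a
nonzero cumulant. -/
theorem IsEtaCircular.apply_starWord_eq {A : Type*} [CStarAlgebra A] {φ : A →ₗ[ℂ] ℂ}
    (h1 : φ 1 = 1) {x : A} (hx : IsEtaCircular φ x) (e e' : Bool) (ε : List Bool) :
    φ (starWord x (e :: e' :: ε)).prod =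
      booleanCumulant φ (starWord x [e, e']) * φ (starWord x ε).prod := by
  -- The summand of index `k` has first block of size `k + 1`, so the surviving index is `1`.
  rw [moment_eq_sum_take φ h1 _ (by simp [starWord]), Finset.sum_eq_single ⟨1, by simp [starWord]⟩]
  · simp [starWord]
  · intro k _ hk
    have hk' : k.val ≠ 1 := fun h => hk (Fin.ext h)
    have hlt : k.val < ε.length + 1 + 1 := by simpa [starWord] using k.isLt
    have : (starWord x (e :: e' :: ε)).take (k + 1) =
        starWord x ((e :: e' :: ε).take (k + 1)) := by
      simp only [starWord, List.map_take]
    rw [this, hx.booleanCumulant_starWord _ (by simp) _, zero_mul]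
    rw [List.length_take, List.length_cons, List.length_cons]
    omega
  · simp

theorem IsEtaCircular.apply_starWord {A : Type*} [CStarAlgebra A] {φ : A →ₗ[ℂ] ℂ}
    (h1 : φ 1 = 1) {x : A} (hx : IsEtaCircular φ x) (e e' : Bool) (ε : List Bool) :
    φ ((starWord x [e, e']).prod * (starWord x ε).prod) =
      φ (starWord x [e, e']).prod * φ (starWord x ε).prod := by
  -- The empty remainder identifies the cumulant with the moment of the two letters.
  have h := hx.apply_starWord_eq h1 e e' []
  have hnil : (starWord x []).prod = 1 := by simp [starWord]
  rw [hnil, h1, mul_one] at h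
  rw [h, ← hx.apply_starWord_eq h1, ← List.prod_append]
  simp [starWord]

/-! ### Entries of the Wigner matrix -/

/-- The index of the unordered pair `{i, k}`. -/
def lowerIndex {n : ℕ} (i k : Fin n) : LowerIndex n := ⟨(max i k, min i k), min_le_max⟩

theorem lowerIndex_of_le {n : ℕ} {i k : Fin n} (h : k ≤ i) : lowerIndex i k = ⟨(i, k), h⟩ := by
  simp [lowerIndex, h]

theorem lowerIndex_comm {n : ℕ} (i k : Fin n) : lowerIndex i k = lowerIndex k i := by
  simp [lowerIndex, max_comm, min_comm]

/-- Distinct entries in one row have distinct generators; this is how inequality of matrix indices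
becomes independence. -/
theorem eq_of_lowerIndex_eq {n : ℕ} {i k l : Fin n} (h : lowerIndex i k = lowerIndex i l) :
    k = l := by
  have h1 : max i k = max i l := congrArg (fun p => p.1.1) h
  have h2 : min i k = min i l := congrArg (fun p => p.1.2) h
  grind

/-- The entry of the unscaled self-adjoint matrix with lower triangular part `a`. -/
def entry {A : Type*} [Star A] {n : ℕ} (a : LowerIndex n → A) (i k : Fin n) : A :=
  if k ≤ i then a (lowerIndex i k) else star (a (lowerIndex i k))

theorem star_entry {A : Type*} [InvolutiveStar A] {n : ℕ} {a : LowerIndex n → A}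
    (ha : ∀ i, IsSelfAdjoint (a ⟨(i, i), le_rfl⟩)) (i k : Fin n) :
    star (entry a i k) = entry a k i := by
  rw [entry, entry, lowerIndex_comm k i]
  rcases lt_trichotomy i k with h | rfl | h
  · rw [if_neg h.not_ge, if_pos h.le, star_star]
  · rw [if_pos le_rfl, lowerIndex_of_le le_rfl, ha]
  · rw [if_pos h.le, if_neg h.not_ge]

theorem entry_eq_prod_starWord {A : Type*} [CStarAlgebra A] {n : ℕ} (a : LowerIndex n → A)
    (i k : Fin n) : ∃ e, entry a i k = (starWord (a (lowerIndex i k)) [e]).prod := by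
  rw [entry]
  split_ifs
  · exact ⟨false, by simp [starWord]⟩
  · exact ⟨true, by simp [starWord]⟩

theorem entry_mem_adjoin {A : Type*} [CStarAlgebra A] {n : ℕ} (a : LowerIndex n → A)
    (i k : Fin n) : entry a i k ∈ NonUnitalStarAlgebra.adjoin ℂ {a (lowerIndex i k)} := by
  rw [entry]
  split_ifs
  · exact NonUnitalStarAlgebra.self_mem_adjoin_singleton ℂ _
  · exact NonUnitalStarAlgebra.star_self_mem_adjoin_singleton ℂ _

theorem entry_mem_closedAdjoin {A : Type*} [CStarAlgebra A] {n : ℕ} (a : LowerIndex n → A)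
    (i k : Fin n) : entry a i k ∈ closedAdjoin a := by
  rw [entry]
  split_ifs
  · exact mem_closedAdjoin a _
  · exact star_mem (mem_closedAdjoin a _)

theorem norm_entry {A : Type*} [CStarAlgebra A] {n : ℕ} (a : LowerIndex n → A)
    (i k : Fin n) : ‖entry a i k‖ = ‖a (lowerIndex i k)‖ := by
  rw [entry]
  split_ifs
  · rfl
  · exact norm_star _

theorem scaledUnit_apply {n : ℕ} (p : LowerIndex n) (i k : Fin n) :
    scaledUnit p i k = if p.1 = (i, k) then
      (if i = k then 1 / (2 * (Real.sqrt n : ℂ)) else 1 / (Real.sqrt n : ℂ)) else 0 := by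
  obtain ⟨⟨r, s⟩, h⟩ := p
  by_cases hp : (r, s) = (i, k)
  · obtain ⟨rfl, rfl⟩ := Prod.mk.inj hp
    rw [scaledUnit]
    split_ifs <;> simp_all
  · rw [if_neg hp, scaledUnit]
    have : ¬(r = i ∧ s = k) := fun h => hp (Prod.ext h.1 h.2)
    split_ifs <;> simp [this]

theorem wignerMatrix_apply {A : Type*} [CStarAlgebra A] {n : ℕ} {a : LowerIndex n → A}
    (ha : ∀ i, IsSelfAdjoint (a ⟨(i, i), le_rfl⟩)) (i k : Fin n) :
    wignerMatrix a i k = (1 / (Real.sqrt n : ℂ)) • entry a i k := by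
  have hterm : ∀ p : LowerIndex n,
      (tens (scaledUnit p) (a p) + tens (scaledUnit p).conjTranspose (star (a p))) i k =
      scaledUnit p i k • a p + star (scaledUnit p k i) • star (a p) := fun p => rfl
  rw [wignerMatrix, Matrix.sum_apply]
  simp only [hterm]
  rw [Finset.sum_eq_single (lowerIndex i k)]
  · rcases lt_trichotomy i k with h | rfl | h
    · rw [entry, if_neg h.not_ge, lowerIndex_comm, lowerIndex_of_le h.le]
      simp [scaledUnit_apply, h.ne, h.ne']
    -- On the diagonal both summands contribute the same element, which cancels the factor `1/2` in
    -- the scaled unit.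
    · rw [entry, if_pos le_rfl, lowerIndex_of_le le_rfl, (ha i).star_eq, ← add_smul]
      congr 1
      simp [scaledUnit_apply]
      ring
    · rw [entry, if_pos h.le, lowerIndex_of_le h.le]
      simp [scaledUnit_apply, h.ne, h.ne']
  · intro p _ hp
    have h1 : p.1 ≠ (i, k) := fun h => hp (by
      have h2 := p.2
      rw [h] at h2
      rw [lowerIndex_of_le h2]
      exact Subtype.ext h)
    have h3 : p.1 ≠ (k, i) := fun h => hp (by
      have h2 := p.2
      rw [h] at h2
      rw [lowerIndex_comm, lowerIndex_of_le h2]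
      exact Subtype.ext h)
    simp [scaledUnit_apply, h1, h3]
  · simp

theorem isHermitian_wignerMatrix {A : Type*} [CStarAlgebra A] {n : ℕ} {a : LowerIndex n → A}
    (ha : ∀ i, IsSelfAdjoint (a ⟨(i, i), le_rfl⟩)) : (wignerMatrix a).IsHermitian := by
  refine Matrix.ext fun i k => ?_
  rw [Matrix.conjTranspose_apply, wignerMatrix_apply ha, wignerMatrix_apply ha, star_smul,
    star_entry ha]
  simp

theorem wignerMatrix_mem_adjoin {A : Type*} [CStarAlgebra A] {n : ℕ} {a : LowerIndex n → A}
    (ha : ∀ i, IsSelfAdjoint (a ⟨(i, i), le_rfl⟩)) (i k : Fin n) :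
    wignerMatrix a i k ∈ NonUnitalStarAlgebra.adjoin ℂ {a (lowerIndex i k)} := by
  rw [wignerMatrix_apply ha]
  exact SMulMemClass.smul_mem _ (entry_mem_adjoin a i k)

theorem resolvent_wignerMatrix_mem {A : Type*} [CStarAlgebra A] {n : ℕ} {a : LowerIndex n → A}
    (ha : ∀ i, IsSelfAdjoint (a ⟨(i, i), le_rfl⟩)) {z : ℂ} (hz : 0 < z.im) (i k : Fin n) :
    resolvent (wignerMatrix a) z i k ∈ closedAdjoin a := by
  refine (isHermitian_wignerMatrix ha).resolvent_apply_mem hz _ (isClosed_closedAdjoin a)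
    (fun i j => ?_) i k
  rw [wignerMatrix_apply ha]
  exact SMulMemClass.smul_mem _ (entry_mem_closedAdjoin a i j)

theorem apply_wignerMatrix_eq_zero {A : Type*} [CStarAlgebra A] {φ : A →ₗ[ℂ] ℂ} (hφ : IsState φ)
    {n : ℕ} {a : LowerIndex n → A} (ha : ∀ i, IsSelfAdjoint (a ⟨(i, i), le_rfl⟩))
    (hc : ∀ p, φ (a p) = 0) (i k : Fin n) : φ (wignerMatrix a i k) = 0 := by
  rw [wignerMatrix_apply ha, map_smul, entry]
  split_ifs
  · rw [hc, smul_zero]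
  · rw [hφ.apply_star, hc, star_zero, smul_zero]

/-! ### Equations for the diagonal resolvent entries -/

theorem sq_mul_apply_resolvent {A : Type*} [CStarAlgebra A] {φ : A →ₗ[ℂ] ℂ} (hφ : IsState φ)
    {n : ℕ} {a : LowerIndex n → A} (hi : BooleanIndepElems φ a)
    (ha : ∀ i, IsSelfAdjoint (a ⟨(i, i), le_rfl⟩)) (hc : ∀ p, φ (a p) = 0) {z : ℂ}
    (hz : 0 < z.im) (i : Fin n) :
    z ^ 2 * φ (resolvent (wignerMatrix a) z i i) =
      z + ∑ k, φ (wignerMatrix a i k * wignerMatrix a k i * resolvent (wignerMatrix a) z i i) := by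
  have hz' := ((isHermitian_wignerMatrix ha).norm_resolvent_apply_le hz).1
  have h0 := apply_wignerMatrix_eq_zero hφ ha hc
  refine sq_mul_apply_eq_of_expansion hφ.map_one (smul_resolvent_apply hz') h0 ?_ i
  intro i k l hl
  rw [hi.apply_mul_mul hφ (fun h => hl ?_) (wignerMatrix_mem_adjoin ha i k)
    (wignerMatrix_mem_adjoin ha k l) (resolvent_wignerMatrix_mem ha hz l i), h0, zero_mul]
  rw [lowerIndex_comm i k] at h
  exact (eq_of_lowerIndex_eq h).symm

/-- The second moment `φ (A_{ik} A_{ki})` of the scaled entries. -/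
noncomputable def secondMoment {n : ℕ} (σ : Fin n → ℝ) (α α' : Fin n → Fin n → ℝ)
    (i k : Fin n) : ℝ :=
  (if i = k then σ i else if k < i then α i k else α' k i) / n

theorem apply_wignerMatrix_mul {A : Type*} [CStarAlgebra A] {φ : A →ₗ[ℂ] ℂ}
    {n : ℕ} {σ : Fin n → ℝ} {α α' : Fin n → Fin n → ℝ} {a : LowerIndex n → A}
    (ha : ∀ i, IsSelfAdjoint (a ⟨(i, i), le_rfl⟩))
    (hd : ∀ i, φ (a ⟨(i, i), le_rfl⟩ ^ 2) = (σ i : ℂ))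
    (hl : ∀ (i j : Fin n) (h : j < i),
      φ (a ⟨(i, j), h.le⟩ * star (a ⟨(i, j), h.le⟩)) = (α i j : ℂ))
    (hr : ∀ (i j : Fin n) (h : j < i),
      φ (star (a ⟨(i, j), h.le⟩) * a ⟨(i, j), h.le⟩) = (α' i j : ℂ)) (i k : Fin n) :
    φ (wignerMatrix a i k * wignerMatrix a k i) = (secondMoment σ α α' i k : ℂ) := by
  have hn : (1 / (Real.sqrt n : ℂ)) * (1 / (Real.sqrt n : ℂ)) = 1 / (n : ℂ) := by
    rw [div_mul_div_comm, one_mul, ← Complex.ofReal_mul, Real.mul_self_sqrt (Nat.cast_nonneg n),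
      Complex.ofReal_natCast]
  rw [wignerMatrix_apply ha, wignerMatrix_apply ha, smul_mul_smul_comm, hn, map_smul, smul_eq_mul,
    secondMoment, entry, entry, lowerIndex_comm k i]
  rcases lt_trichotomy i k with h | rfl | h
  · rw [if_neg h.not_ge, if_pos h.le, lowerIndex_comm, lowerIndex_of_le h.le, hr k i h,
      if_neg h.ne, if_neg h.not_gt]
    push_cast
    ring
  · rw [if_pos le_rfl, lowerIndex_of_le le_rfl, ← sq, hd, if_pos rfl]
    push_cast
    ring
  · rw [if_neg h.not_ge, if_pos h.le, lowerIndex_of_le h.le, hl i k h, if_neg h.ne', if_pos h]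
    push_cast
    ring

/-- `M i k * M k i` is a two-letter word in one generator, so it splits off from `G i i` exactly and
the expansion closes. -/
theorem IsBernoulliCircularFamily.sub_mul_apply_resolvent {A : Type*} [CStarAlgebra A]
    {φ : A →ₗ[ℂ] ℂ} (hφ : IsState φ) {n : ℕ} {σ : Fin n → ℝ} {α α' : Fin n → Fin n → ℝ}
    {b : LowerIndex n → A} (hb : IsBernoulliCircularFamily φ σ α α' b) {z : ℂ} (hz : 0 < z.im)
    (i : Fin n) :
    (z ^ 2 - ((∑ k, secondMoment σ α α' i k : ℝ) : ℂ)) *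
      φ (resolvent (wignerMatrix b) z i i) = z := by
  have hsa : ∀ i, IsSelfAdjoint (b ⟨(i, i), le_rfl⟩) := fun i => (hb.diag_bernoulli i).selfAdjoint
  have hc : ∀ p, φ (b p) = 0 := by
    rintro ⟨⟨i, j⟩, h⟩
    rcases h.lt_or_eq with h | h
    · exact hb.centered i j h
    · simp only at h
      subst h
      simpa using (hb.diag_bernoulli j).moment_odd 0
  have hd : ∀ i, φ (b ⟨(i, i), le_rfl⟩ ^ 2) = (σ i : ℂ) := fun i => by
    simpa using (hb.diag_bernoulli i).moment_even 1
  rw [sub_mul, sq_mul_apply_resolvent hφ hb.indep hsa hc hz, Complex.ofReal_sum, Finset.sum_mul,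
    sub_eq_iff_eq_add]
  refine congrArg (z + ·) (Finset.sum_congr rfl fun k _ => ?_)
  rw [← apply_wignerMatrix_mul hsa hd hb.var_left hb.var_right]
  have hm : wignerMatrix b k i ∈ NonUnitalStarAlgebra.adjoin ℂ {b (lowerIndex i k)} := by
    rw [lowerIndex_comm]
    exact wignerMatrix_mem_adjoin hsa k i
  refine hb.indep.apply_mul hφ (mul_mem (wignerMatrix_mem_adjoin hsa i k) hm) (fun v hv => ?_)
    (resolvent_wignerMatrix_mem hsa hz i i)
  refine apply_mul_eq_of_starWord (fun ε => ?_) hv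
  rw [wignerMatrix_apply hsa, wignerMatrix_apply hsa, smul_mul_smul_comm, smul_mul_assoc,
    map_smul, map_smul, smul_mul_assoc]
  congr 1
  by_cases hik : i = k
  · subst hik
    rw [entry, if_pos le_rfl, lowerIndex_of_le le_rfl]
    exact (hb.diag_bernoulli i).apply_starWord ε
  · have hη : IsEtaCircular φ (b (lowerIndex i k)) := by
      rcases lt_or_gt_of_ne hik with h | h
      · rw [lowerIndex_comm, lowerIndex_of_le h.le]
        exact hb.etaCircular k i h
      · rw [lowerIndex_of_le h.le]
        exact hb.etaCircular i k h
    obtain ⟨e, he⟩ := entry_eq_prod_starWord b i k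
    obtain ⟨e', he'⟩ := entry_eq_prod_starWord b k i
    rw [lowerIndex_comm k i] at he'
    have : (starWord (b (lowerIndex i k)) [e, e']).prod = entry b i k * entry b k i := by
      rw [he, he', ← List.prod_append]
      rfl
    rw [← this]
    exact hη.apply_starWord hφ.map_one e e' ε

theorem IsBooleanWignerFamily.norm_sub_mul_apply_resolvent_le {A : Type*} [CStarAlgebra A]
    {φ : A →ₗ[ℂ] ℂ} (hφ : IsState φ) {n : ℕ} {σ : Fin n → ℝ} {α α' : Fin n → Fin n → ℝ}
    {a : LowerIndex n → A} (ha : IsBooleanWignerFamily φ σ α α' a) {z : ℂ} (hz : 0 < z.im)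
    (i : Fin n) :
    ‖(z ^ 2 - ((∑ k, secondMoment σ α α' i k : ℝ) : ℂ)) *
      φ (resolvent (wignerMatrix a) z i i) - z‖ ≤
      2 / z.im ^ 2 * (⨆ p, ‖a p‖ ^ 3) * (1 / Real.sqrt n) := by
  have hsa := ha.diag_selfAdjoint
  obtain ⟨hz', hG⟩ := (isHermitian_wignerMatrix hsa).norm_resolvent_apply_le hz
  have hw := apply_wignerMatrix_mul hsa ha.diag_var ha.var_left ha.var_right
  set M := wignerMatrix a
  set G := resolvent M z
  have hmem : ∀ i k, M i k ∈ NonUnitalStarAlgebra.adjoin ℂ {a (lowerIndex i k)} :=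
    wignerMatrix_mem_adjoin hsa
  have hmem' : ∀ i k, M k i ∈ NonUnitalStarAlgebra.adjoin ℂ {a (lowerIndex i k)} := fun i k => by
    rw [lowerIndex_comm]
    exact hmem k i
  have hznorm : z.im ≤ ‖z‖ := (le_abs_self _).trans (Complex.abs_im_le_norm z)
  have hz0 : z ≠ 0 := norm_pos_iff.mp (hz.trans_le hznorm)
  set S : ℝ := ⨆ p, ‖a p‖ ^ 3
  set s : ℝ := 1 / Real.sqrt n
  have hs : 0 ≤ s := by positivity
  have hMn : ∀ i k, ‖M i k‖ = s * ‖a (lowerIndex i k)‖ := fun i k => by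
    have h : M i k = (1 / (Real.sqrt n : ℂ)) • entry a i k := wignerMatrix_apply hsa i k
    rw [h, norm_smul, norm_entry, norm_div, norm_one, Complex.norm_real,
      Real.norm_of_nonneg (Real.sqrt_nonneg _)]
  -- One factor `1 / Im z` bounds the entry of `G`, the other comes from dividing by `z`; the `2`
  -- counts the two parts of the defect.
  have hterm : ∀ k, ‖φ (M i k * M k i * G i i) - (secondMoment σ α α' i k : ℂ) * φ (G i i)‖ ≤
      2 / z.im ^ 2 * S * s ^ 3 := fun k => by
    have h := mul_apply_mul_mul_eq_of_expansion hφ.map_one (smul_resolvent_apply hz')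
      (fun i k l hl => ha.indep.apply_mul_mul hφ (fun h => hl (eq_of_lowerIndex_eq h).symm)
        (mul_mem (hmem i k) (hmem' i k)) (hmem i l) (resolvent_wignerMatrix_mem hsa hz l i)) i k
    rw [← sub_eq_iff_eq_add', ← mul_sub] at h
    rw [← hw, eq_div_of_mul_eq hz0 ((mul_comm _ _).trans h), norm_div]
    have hS : ‖a (lowerIndex i k)‖ ^ 3 ≤ S :=
      le_ciSup (f := fun p => ‖a p‖ ^ 3) (Set.finite_range _).bddAbove (lowerIndex i k)
    have b1 : ‖M i k * M k i‖ ≤ (s * ‖a (lowerIndex i k)‖) ^ 2 := by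
      refine (norm_mul_le _ _).trans_eq ?_
      rw [hMn, hMn, lowerIndex_comm k i, pow_two]
    have b2 : ‖M i k * G k i‖ ≤ s * ‖a (lowerIndex i k)‖ * (1 / z.im) := by
      refine (norm_mul_le _ _).trans ?_
      rw [hMn]
      gcongr
      exact hG k i
    have b3 : (s * ‖a (lowerIndex i k)‖) ^ 2 * (s * ‖a (lowerIndex i k)‖ * (1 / z.im)) ≤
        S * s ^ 3 / z.im := by
      calc _ = ‖a (lowerIndex i k)‖ ^ 3 * s ^ 3 / z.im := by ring
        _ ≤ _ := by gcongr
    have b4 : ‖φ (M i k * M k i * (M i k * G k i)) - φ (M i k * M k i) * φ (M i k * G k i)‖ ≤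
        2 * (S * s ^ 3 / z.im) := by
      refine (norm_sub_le _ _).trans ?_
      rw [two_mul, norm_mul]
      refine add_le_add ?_ ?_
      · refine (hφ.norm_apply_le _).trans ((norm_mul_le _ _).trans (le_trans ?_ b3))
        gcongr
      · refine le_trans ?_ b3
        gcongr
        · exact (hφ.norm_apply_le _).trans b1
        · exact (hφ.norm_apply_le _).trans b2
    calc _ ≤ 2 * (S * s ^ 3 / z.im) / z.im :=
          div_le_div₀ ((norm_nonneg _).trans b4) b4 hz hznorm
      _ = _ := by field_simp
  have hsum : (z ^ 2 - ((∑ k, secondMoment σ α α' i k : ℝ) : ℂ)) * φ (G i i) - z =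
      ∑ k, (φ (M i k * M k i * G i i) - (secondMoment σ α α' i k : ℂ) * φ (G i i)) := by
    rw [sub_mul, sq_mul_apply_resolvent hφ ha.indep hsa ha.centered hz, Complex.ofReal_sum,
      Finset.sum_mul, Finset.sum_sub_distrib]
    ring
  -- There are `n` errors of order `s ^ 3` with `s = n^(-1/2)`, totalling order `s`.
  have hns : (n : ℝ) * s ^ 3 = s := by
    have hn : (0 : ℝ) < n := Nat.cast_pos.mpr (i.pos)
    have h1 := Real.sqrt_pos.mpr hn
    have h2 : (n : ℝ) = Real.sqrt n ^ 2 := (Real.sq_sqrt hn.le).symm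
    have h3 : Real.sqrt n * s = 1 := mul_one_div_cancel h1.ne'
    calc (n : ℝ) * s ^ 3 = (Real.sqrt n * s) ^ 2 * s := by rw [mul_pow, ← h2]; ring
      _ = s := by rw [h3]; ring
  rw [hsum]
  calc _ ≤ ∑ _k : Fin n, 2 / z.im ^ 2 * S * s ^ 3 := norm_sum_le_of_le _ fun k _ => hterm k
    _ = 2 / z.im ^ 2 * S * (n * s ^ 3) := by
      rw [Finset.sum_const, Finset.card_univ, Fintype.card_fin, nsmul_eq_mul]
      ring
    _ = _ := by rw [hns]

/-! ### Stability and the final comparison -/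

/-- Both factors of `z² - d = (z - √d)(z + √d)` have imaginary part `Im z`. -/
theorem im_sq_le_norm_sq_sub {z : ℂ} (hz : 0 < z.im) {d : ℝ} (hd : 0 ≤ d) :
    z.im ^ 2 ≤ ‖z ^ 2 - (d : ℂ)‖ := by
  have h : z ^ 2 - (d : ℂ) = (z - (Real.sqrt d : ℂ)) * (z + (Real.sqrt d : ℂ)) := by
    have : (d : ℂ) = (Real.sqrt d : ℂ) ^ 2 := by
      rw [← Complex.ofReal_pow, Real.sq_sqrt hd]
    rw [this]
    ring
  have h1 := (le_abs_self _).trans (Complex.abs_im_le_norm (z - (Real.sqrt d : ℂ)))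
  have h2 := (le_abs_self _).trans (Complex.abs_im_le_norm (z + (Real.sqrt d : ℂ)))
  rw [Complex.sub_im, Complex.ofReal_im, sub_zero] at h1
  rw [Complex.add_im, Complex.ofReal_im, add_zero] at h2
  rw [h, norm_mul, sq]
  gcongr

/-- It is the value of the state on `M* M` for the entry `M` at `(k, i)`. -/
theorem IsBooleanWignerFamily.secondMoment_nonneg {A : Type*} [CStarAlgebra A]
    {φ : A →ₗ[ℂ] ℂ} (hφ : IsState φ) {n : ℕ} {σ : Fin n → ℝ} {α α' : Fin n → Fin n → ℝ}
    {a : LowerIndex n → A} (ha : IsBooleanWignerFamily φ σ α α' a) (i k : Fin n) :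
    0 ≤ secondMoment σ α α' i k := by
  have h := hφ.nonneg (wignerMatrix a k i)
  have h2 : star (wignerMatrix a k i) = wignerMatrix a i k :=
    congrFun (congrFun (isHermitian_wignerMatrix ha.diag_selfAdjoint) i) k
  rw [h2, apply_wignerMatrix_mul ha.diag_selfAdjoint ha.diag_var ha.var_left ha.var_right] at h
  exact Complex.zero_le_real.mp h

end BooleanMatrix

theorem theorem5p5 {A A' : Type*} [CStarAlgebra A] [CStarAlgebra A']
    (φ : A →ₗ[ℂ] ℂ) (hφ : BooleanMatrix.IsState φ)
    (ψ : A' →ₗ[ℂ] ℂ) (hψ : BooleanMatrix.IsState ψ)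
    (n : ℕ) (hn : 1 ≤ n) (σ : Fin n → ℝ) (α α' : Fin n → Fin n → ℝ)
    (a : BooleanMatrix.LowerIndex n → A) (b : BooleanMatrix.LowerIndex n → A')
    (ha : BooleanMatrix.IsBooleanWignerFamily φ σ α α' a)
    (hb : BooleanMatrix.IsBernoulliCircularFamily ψ σ α α' b)
    (z : ℂ) (hz : 0 < z.im) :
    z ∈ resolventSet ℂ (BooleanMatrix.wignerMatrix a) ∧
    z ∈ resolventSet ℂ (BooleanMatrix.wignerMatrix b) ∧
    ‖BooleanMatrix.trTensor φ (resolvent (BooleanMatrix.wignerMatrix a) z) -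
        BooleanMatrix.trTensor ψ (resolvent (BooleanMatrix.wignerMatrix b) z)‖ ≤
      16 / z.im ^ 4 * (⨆ p : BooleanMatrix.LowerIndex n, ‖a p‖ ^ 3) * (1 / Real.sqrt n) := by
  have hHa := BooleanMatrix.isHermitian_wignerMatrix ha.diag_selfAdjoint
  have hHb := BooleanMatrix.isHermitian_wignerMatrix fun i => (hb.diag_bernoulli i).selfAdjoint
  refine ⟨(hHa.norm_resolvent_apply_le hz).1, (hHb.norm_resolvent_apply_le hz).1, ?_⟩
  set S : ℝ := ⨆ p : BooleanMatrix.LowerIndex n, ‖a p‖ ^ 3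
  have hS : 0 ≤ S := Real.iSup_nonneg fun p => by positivity
  have hn0 : (0 : ℝ) < n := by exact_mod_cast hn
  have hdiff : ∀ i, ‖φ (resolvent (BooleanMatrix.wignerMatrix a) z i i) -
      ψ (resolvent (BooleanMatrix.wignerMatrix b) z i i)‖ ≤
      2 / z.im ^ 4 * S * (1 / Real.sqrt n) := fun i => by
    have h1 := ha.norm_sub_mul_apply_resolvent_le hφ hz i
    have h2 := hb.sub_mul_apply_resolvent hψ hz i
    have h3 := BooleanMatrix.im_sq_le_norm_sq_sub hz
      (Finset.sum_nonneg (s := Finset.univ) fun k _ => ha.secondMoment_nonneg hφ i k)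
    -- Only the subtracted `z` is replaced by its exact expression from the second model, so that
    -- the common factor `z² - d_i` can be pulled out.
    nth_rewrite 3 [← h2] at h1
    rw [← mul_sub, norm_mul] at h1
    refine le_of_mul_le_mul_left ?_ (pow_pos hz 2)
    calc _ ≤ _ := mul_le_mul_of_nonneg_right h3 (norm_nonneg _)
      _ ≤ _ := h1
      _ = _ := by
        field_simp
        rfl
  rw [BooleanMatrix.trTensor, BooleanMatrix.trTensor, ← mul_sub, ← Finset.sum_sub_distrib,
    norm_mul, norm_div, norm_one, Complex.norm_natCast]
  calc _ ≤ 1 / (n : ℝ) * ∑ _i : Fin n, 2 / z.im ^ 4 * S * (1 / Real.sqrt n) := by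
        gcongr
        exact norm_sum_le_of_le _ fun i _ => hdiff i
    _ = 2 / z.im ^ 4 * S * (1 / Real.sqrt n) := by
      rw [Finset.sum_const, Finset.card_univ, Fintype.card_fin, nsmul_eq_mul, ← mul_assoc,
        one_div_mul_cancel hn0.ne', one_mul]
    -- The argument yields the constant `2`, which is relaxed to `16`.
    _ ≤ _ := by
      gcongr
      norm_num
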